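/- Call $f:\mathbb N\to\mathbb N$ polynomially bounded if $f(n)\le p(n)$ for all $n$ and some polynomial $p$. A Boolean circuit with $n$ inputs is a finite directed acyclic graph of input, NOT, and unbounded fan-in AND and OR gates with one output gate; its size is the number of gates and its depth is the maximal number of NOT, AND and OR gates on a path ending in the output gate. A (non-uniform) $\mathrm{AC}^0$ family is a sequence $\{C_n\}_{n\in\mathbb N}$ of circuits, $C_n$ with $n$ inputs, of polynomially bounded size and bounded depth. A decoder-only (autoregressive) Transformer with maximal input length $n$ over the alphabet $\{0,1\}$ has hidden dimension $d=H d_k$, $H$ heads and $L$ layers. On tokens $s_1,\dots,s_n$ it computes $\mathbf x_i^0=\mathrm{Embed}(s_i)+\mathrm{pos}(i)\in\mathbb R^d$ and, for $l=1,\dots,L$, $$\mathbf a_i^l=\mathbf x_i^{l-1}+\sum_{h=1}^{H}\Big(\sum_{j\le i}\alpha^{(l,h)}_{ij}\,\mathbf x_j^{l-1}W_v^{(l,h)}\Big)W_o^{(l,h)},\qquad (\alpha^{(l,h)}_{ij})_{j\le i}=\mathrm{softmax}_{j\le i}\Big(\tfrac{(\mathbf x_i^{l-1}W_q^{(l,h)})(\mathbf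 x_j^{l-1}W_k^{(l,h)})^{T}}{\sqrt{d_k}}\Big),$$ $$\mathbf x_i^l=\mathbf a_i^l+\mathrm{GeLU}(\mathbf a_i^lW_1^l+\mathbf b_1^l)W_2^l,$$ where $W_q^{(l,h)},W_k^{(l,h)},W_v^{(l,h)}\in\mathbb R^{d\times d_k}$, $W_o^{(l,h)}\in\mathbb R^{d_k\times d}$, $W_1^l,W_2^l\in\mathbb R^{d\times d}$, $\mathbf b_1^l\in\mathbb R^d$, and $\mathrm{GeLU}(x)=x\Phi(x)$ with $\Phi$ the standard normal distribution function. The next-token probabilities are $\mathrm{softmax}(\mathbf x_n^LW_{\rm out})$ with $W_{\rm out}\in\mathbb R^{d\times 2}$; the Transformer generates a token if that token is the unique most probable one. Its size is its number of parameters. A number format is either fixed-point (a sign, $a$ bits before and $b$ bits after the binary point) or floating-point ($m2^e$ with a signed $a$-bit integer $m$ and a signed $b$-bit integer $e$). A Transformer is run in a number format with a truncation method (round to nearest, towards zero, up, or down, with numbers out of range sent to the nearest representable extreme) if all its parameters are representable in the format and every neuron (embedding; query, key and value entries; attention score; attention weight; head output; summed head outputs; residual sum; pre-activation; GeLU value;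 feed-forward output; logit; next-token probability) is truncated as soon as it is computed. A family $\{T_n\}$ is log-precision if $T_n$ is run in a format with $O(\log n)$ bits. **Statement.** Fix the kind of format (fixed- or floating-point) and one of the four truncation methods. For every non-uniform $\mathrm{AC}^0$ circuit family $\{C_n\}_{n\in\mathbb N}$ there is a family $\{T_n\}_{n\in\mathbb N}$ of log-precision decoder-only Transformers of polynomially bounded size and with a bounded number of layers that simulates $\{C_n\}$: for every $n\ge 1$ and every $x\in\{0,1\}^n$, $T_n$ on the input tokens $x_1,\dots,x_n$ generates the token $C_n(x)$. -/

import Mathlib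

open Asymptotics

/-! ### Growth conditions -/

/-- `f n = poly(n)`. -/
def PolyBounded (f : ℕ → ℕ) : Prop :=
  ∃ p : Polynomial ℕ, ∀ n, f n ≤ p.eval n

/-- `f n = O(log n)`. -/
def LogBounded (f : ℕ → ℕ) : Prop :=
  (fun n => (f n : ℝ)) =O[Filter.atTop] fun n => Real.log (n : ℝ)

/-! ### Boolean circuits with unbounded fan-in -/

/-- The gate at place `g` of a topologically sorted circuit with `n` input bits; it reads only
earlier gates. The empty conjunction is the constant true, the empty disjunction the constant
false. -/
inductive Gate (n g : ℕ) : Type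
  | input (i : Fin n) : Gate n g
  | not (j : Fin g) : Gate n g
  | and (s : Finset (Fin g)) : Gate n g
  | or (s : Finset (Fin g)) : Gate n g

/-- A circuit with `n` input bits and one output bit: a topologically sorted directed acyclic
graph of gates. -/
structure BoolCircuit (n : ℕ) where
  /-- the number of gates -/
  size : ℕ
  gate : (g : Fin size) → Gate n g
  output : Fin size

namespace BoolCircuit

variable {n : ℕ}

/-- The value of gate `g` on the input `x`. -/
def val (C : BoolCircuit n) (x : Fin n → Bool) (g : Fin C.size) : Bool :=
  match C.gate g with
  | .input i => x i
  | .not j => !(C.val x ⟨j, j.isLt.trans g.isLt⟩)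
  | .and s => decide (∀ j ∈ s, C.val x ⟨j, j.isLt.trans g.isLt⟩ = true)
  | .or s => decide (∃ j ∈ s, C.val x ⟨j, j.isLt.trans g.isLt⟩ = true)
termination_by g.val
decreasing_by all_goals exact Fin.isLt _

/-- The number of NOT, AND and OR gates on a longest path ending in gate `g`. -/
def gateDepth (C : BoolCircuit n) (g : Fin C.size) : ℕ :=
  match C.gate g with
  | .input _ => 0
  | .not j => C.gateDepth ⟨j, j.isLt.trans g.isLt⟩ + 1
  | .and s => (s.sup fun j => C.gateDepth ⟨j, j.isLt.trans g.isLt⟩) + 1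
  | .or s => (s.sup fun j => C.gateDepth ⟨j, j.isLt.trans g.isLt⟩) + 1
termination_by g.val
decreasing_by all_goals exact Fin.isLt _

/-- The Boolean function computed by the circuit. -/
def eval (C : BoolCircuit n) (x : Fin n → Bool) : Bool := C.val x C.output

def depth (C : BoolCircuit n) : ℕ := C.gateDepth C.output

end BoolCircuit

/-- A (non-uniform) `AC⁰` circuit family: polynomial size, constant depth, unbounded fan-in. -/
def IsAC0Family (C : (n : ℕ) → BoolCircuit n) : Prop :=
  PolyBounded (fun n => (C n).size) ∧ ∃ D : ℕ, ∀ n, (C n).depth ≤ D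

/-! ### Finite-precision numbers -/

/-- The two ways of storing real numbers. -/
inductive FormatKind : Type
  | fixedPoint
  | floatingPoint

namespace FormatKind

/-- The numbers that can be stored. Fixed-point format: a sign, `a` bits before and `b` bits after
the binary point. Floating-point format: `m * 2 ^ e` with a sign and `a` bits for the integer
mantissa `m`, and a sign and `b` bits for the exponent `e`. -/
def values : FormatKind → ℕ → ℕ → Set ℝ
  | fixedPoint, a, b => {x | ∃ k : ℤ, |k| < 2 ^ (a + b) ∧ x = (k : ℝ) / 2 ^ b}
  | floatingPoint, a, b => {x | ∃ m e : ℤ, |m| < 2 ^ a ∧ |e| < 2 ^ b ∧ x = (m : ℝ) * (2 : ℝ) ^ e}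

/-- The number of bits that a stored number occupies. -/
def bits : FormatKind → ℕ → ℕ → ℕ
  | fixedPoint, a, b => a + b + 1
  | floatingPoint, a, b => (a + 1) + (b + 1)

end FormatKind

/-- The four truncation methods. -/
inductive RoundingMode : Type
  | toNearest
  | towardZero
  | up
  | down

/-- `ρ` truncates every real number to one of the numbers in `F` by the given method. Numbers out
of range are mapped to the extreme element of `F`; ties in round-to-nearest may be broken in any
way. -/
def RoundingMode.IsRounding (r : RoundingMode) (F : Set ℝ) (ρ : ℝ → ℝ) : Prop :=
  ∀ x, ρ x ∈ F ∧
    match r with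
    | .toNearest => ∀ y ∈ F, |ρ x - x| ≤ |y - x|
    | .towardZero => ρ x ∈ Set.uIcc 0 x ∧ ∀ y ∈ F, y ∈ Set.uIcc 0 x → |y| ≤ |ρ x|
    | .up => (x ≤ ρ x ∧ ∀ y ∈ F, x ≤ y → ρ x ≤ y) ∨ (ρ x < x ∧ ∀ y ∈ F, y ≤ ρ x)
    | .down => (ρ x ≤ x ∧ ∀ y ∈ F, y ≤ x → y ≤ ρ x) ∨ (x < ρ x ∧ ∀ y ∈ F, ρ x ≤ y)

/-! ### Decoder-only Transformers -/

/-- The Gaussian error linear unit `x ↦ x Φ(x)`, with `Φ` the standard normal distribution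
function. -/
noncomputable def gelu (x : ℝ) : ℝ :=
  x * ProbabilityTheory.cdf (ProbabilityTheory.gaussianReal 0 1) x

/-- The parameters of one layer with `H` heads of dimension `dk` and hidden dimension
`d = H * dk`. -/
structure TransformerLayer (H dk : ℕ) where
  Wq : Fin H → Matrix (Fin (H * dk)) (Fin dk) ℝ
  Wk : Fin H → Matrix (Fin (H * dk)) (Fin dk) ℝ
  Wv : Fin H → Matrix (Fin (H * dk)) (Fin dk) ℝ
  Wo : Fin H → Matrix (Fin dk) (Fin (H * dk)) ℝ
  W₁ : Matrix (Fin (H * dk)) (Fin (H * dk)) ℝ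
  b₁ : Fin (H * dk) → ℝ
  W₂ : Matrix (Fin (H * dk)) (Fin (H * dk)) ℝ

namespace TransformerLayer

variable {H dk n : ℕ}

/-- All parameters of the layer lie in `F`. -/
def ParamsIn (ℓ : TransformerLayer H dk) (F : Set ℝ) : Prop :=
  (∀ h i c, ℓ.Wq h i c ∈ F) ∧ (∀ h i c, ℓ.Wk h i c ∈ F) ∧ (∀ h i c, ℓ.Wv h i c ∈ F) ∧
  (∀ h c i, ℓ.Wo h c i ∈ F) ∧ (∀ i j, ℓ.W₁ i j ∈ F) ∧ (∀ i, ℓ.b₁ i ∈ F) ∧ (∀ i j, ℓ.W₂ i j ∈ F)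

/-! The forward pass of a layer on a sequence `X` of `n` row vectors. Every neuron is truncated
by `ρ` as soon as it is computed; `ρ = id` is the infinite-precision Transformer. -/

variable (ρ : ℝ → ℝ)

/-- A linear map without bias applied to a row vector, with truncated output. -/
def linear {p q : ℕ} (x : Fin p → ℝ) (W : Matrix (Fin p) (Fin q) ℝ) (c : Fin q) : ℝ :=
  ρ (∑ e, x e * W e c)

variable (ℓ : TransformerLayer H dk) (X : Fin n → Fin (H * dk) → ℝ)

/-- The scaled inner product of the query at position `i` and the key at position `j`. -/
noncomputable def score (h : Fin H) (i j : Fin n) : ℝ :=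
  ρ ((∑ c, linear ρ (X i) (ℓ.Wq h) c * linear ρ (X j) (ℓ.Wk h) c) / √(dk : ℝ))

/-- The causal softmax: position `i` attends to the positions `j ≤ i`. -/
noncomputable def weight (h : Fin H) (i j : Fin n) : ℝ :=
  ρ (Real.exp (ℓ.score ρ X h i j) / ∑ j' ∈ Finset.Iic i, Real.exp (ℓ.score ρ X h i j'))

/-- The output of one attention head. -/
noncomputable def head (h : Fin H) (i : Fin n) (c : Fin dk) : ℝ :=
  ρ (∑ j ∈ Finset.Iic i, ℓ.weight ρ X h i j * linear ρ (X j) (ℓ.Wv h) c)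

/-- Multi-head attention. -/
noncomputable def multiHead (i : Fin n) (e : Fin (H * dk)) : ℝ :=
  ρ (∑ h, ∑ c, ℓ.head ρ X h i c * ℓ.Wo h c e)

/-- Multi-head attention with the residual connection. -/
noncomputable def attention (i : Fin n) (e : Fin (H * dk)) : ℝ :=
  ρ (ℓ.multiHead ρ X i e + X i e)

/-- The feed-forward network `GeLU(x W₁ + b₁) W₂`. -/
noncomputable def ffn (x : Fin (H * dk) → ℝ) : Fin (H * dk) → ℝ :=
  linear ρ (fun e => ρ (gelu (ρ ((∑ e', x e' * ℓ.W₁ e' e) + ℓ.b₁ e)))) ℓ.W₂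

/-- The output of the layer. -/
noncomputable def forward (i : Fin n) (e : Fin (H * dk)) : ℝ :=
  ρ (ℓ.attention ρ X i e + ℓ.ffn ρ (ℓ.attention ρ X i) e)

end TransformerLayer

/-- A decoder-only Transformer over the token alphabet `{0, 1}` with maximal input length `n`. -/
structure Transformer (n : ℕ) where
  /-- the number `H` of attention heads per layer -/
  heads : ℕ
  /-- the dimension `d_k` of a head; the hidden dimension is `d = H * d_k` -/
  headDim : ℕ
  /-- the number `L` of layers -/
  numLayers : ℕ
  embed : Bool → Fin (heads * headDim) → ℝ
  pos : Fin n → Fin (heads * headDim) → ℝ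
  layer : Fin numLayers → TransformerLayer heads headDim
  /-- the output layer, from the hidden dimension to the token alphabet -/
  unembed : Fin (heads * headDim) → Bool → ℝ

namespace Transformer

variable {n : ℕ}

/-- The hidden dimension. -/
def dim (T : Transformer n) : ℕ := T.heads * T.headDim

/-- The number of parameters: embedding, position embedding, layers
(`Wq, Wk, Wv, Wo` per head, and `W₁, W₂, b₁`), output layer. -/
def size (T : Transformer n) : ℕ :=
  2 * T.dim + n * T.dim +
    T.numLayers * (T.heads * (4 * (T.dim * T.headDim)) + 2 * T.dim ^ 2 + T.dim) + 2 * T.dim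

/-- All parameters of the Transformer lie in `F`. -/
def ParamsIn (T : Transformer n) (F : Set ℝ) : Prop :=
  (∀ t e, T.embed t e ∈ F) ∧ (∀ i e, T.pos i e ∈ F) ∧ (∀ l, (T.layer l).ParamsIn F) ∧
  (∀ e t, T.unembed e t ∈ F)

/-- The hidden states after the first `l` layers on the token sequence `s`. -/
noncomputable def hidden (T : Transformer n) (ρ : ℝ → ℝ) (s : Fin n → Bool) :
    (l : ℕ) → l ≤ T.numLayers → Fin n → Fin (T.heads * T.headDim) → ℝ
  | 0, _ => fun i e => ρ (T.embed (s i) e + T.pos i e)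
  | l + 1, h => (T.layer ⟨l, h⟩).forward ρ (T.hidden ρ s l (Nat.le_of_succ_le h))

noncomputable def logit (T : Transformer n) (ρ : ℝ → ℝ) (s : Fin n → Bool) (i : Fin n)
    (t : Bool) : ℝ :=
  ρ (∑ e, T.hidden ρ s T.numLayers le_rfl i e * T.unembed e t)

/-- The probability, by the final softmax at position `i`, that the next token is `t`. -/
noncomputable def nextProb (T : Transformer n) (ρ : ℝ → ℝ) (s : Fin n → Bool) (i : Fin n)
    (t : Bool) : ℝ :=
  ρ (Real.exp (T.logit ρ s i t) / ∑ t', Real.exp (T.logit ρ s i t'))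

/-- Having read all of `s`, the Transformer generates the token `t`: at the last position `t` is
the unique most probable next token. -/
def Generates (T : Transformer n) (ρ : ℝ → ℝ) (s : Fin n → Bool) (t : Bool) : Prop :=
  ∀ i : Fin n, i.val + 1 = n → ∀ t', t' ≠ t → T.nextProb ρ s i t' < T.nextProb ρ s i t

end Transformer

/-! Overflow does the work of unbounded fan-in. Encode false as 0 and true as the largest
representable number `M`. A sum of such codes is truncated to `M` as soon as one summand is `M`, and
is 0 otherwise, so one truncated neuron computes an OR of any number of inputs exactly
(`round_sum_enc`). Negation is `M - x`, available because one coordinate constantly holds `M`. By De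
Morgan, if AND gates are stored negated, every non-input gate becomes an OR of literals in stored
values (`stored_eq_true_iff`). One feed-forward layer per depth level therefore suffices.

Two operations damage the code `M`: GeLU may shrink it to about `M / 2`, and uniform attention
shrinks it to about `M / n`. A value of at least `M / 2 ^ j` is repaired by multiplying its
truncation by `2 ^ (j + 1)` and overflowing again (`scale_up`); the extra factor 2 pays for the
truncation error. Zero is never disturbed. Hence all states that matter are exactly 0 or `M`, and no
error accumulates.

The only properties of truncation that enter are those in `RoundsInto`, which makes the argument
uniform in the four methods; the only properties of the format are those in `HasRange`, which hold
with `q + 4` bits for each part of a number, where `2 ^ q` bounds the input length plus the circuit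
size. Attention is used in the first layer only, to bring all input bits to the last position. -/

/-! ### Truncation and saturation -/

/-- The properties common to all truncation methods: the result lies in `F`, and no element of `F`
is jumped over. -/
structure RoundsInto (F : Set ℝ) (ρ : ℝ → ℝ) : Prop where
  mem : ∀ x, ρ x ∈ F
  le_of_le : ∀ {x y}, y ∈ F → x ≤ y → ρ x ≤ y
  ge_of_ge : ∀ {x y}, y ∈ F → y ≤ x → y ≤ ρ x

/-- An element of `F` lying between `x` and its truncation would always have been the better choice.
Truncation toward zero needs a split by signs; for `up` and `down` the second alternative is the
out-of-range case. -/
theorem RoundingMode.IsRounding.roundsInto {r : RoundingMode} {F : Set ℝ} {ρ : ℝ → ℝ}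
    (h : r.IsRounding F ρ) : RoundsInto F ρ := by
  refine ⟨fun x => (h x).1, fun {x y} hy hxy => ?_, fun {x y} hy hxy => ?_⟩
  · have hx := (h x).2
    cases r with
    | toNearest =>
      by_contra! hlt
      have := hx y hy
      rw [abs_of_nonneg (by linarith), abs_of_nonneg (by linarith)] at this
      linarith
    | towardZero =>
      obtain ⟨h1, h2⟩ := hx
      rcases le_total 0 x with h0 | h0
      · rw [Set.uIcc_of_le h0] at h1
        exact h1.2.trans hxy
      · rw [Set.uIcc_of_ge h0] at h1 h2
        rcases le_total 0 y with hy0 | hy0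
        · exact h1.2.trans hy0
        · have := h2 y hy ⟨hxy, hy0⟩
          rw [abs_of_nonpos hy0, abs_of_nonpos h1.2] at this
          linarith
    | up => exact hx.elim (fun h => h.2 y hy hxy) (fun h => h.1.le.trans hxy)
    | down => exact hx.elim (fun h => h.1.trans hxy) (fun h => h.2 y hy)
  · have hx := (h x).2
    cases r with
    | toNearest =>
      by_contra! hlt
      have := hx y hy
      rw [abs_of_nonpos (by linarith), abs_of_nonpos (by linarith)] at this
      linarith
    | towardZero =>
      obtain ⟨h1, h2⟩ := hx
      rcases le_total 0 x with h0 | h0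
      · rw [Set.uIcc_of_le h0] at h1 h2
        rcases le_total 0 y with hy0 | hy0
        · have := h2 y hy ⟨hy0, hxy⟩
          rwa [abs_of_nonneg hy0, abs_of_nonneg h1.1] at this
        · exact hy0.trans h1.1
      · rw [Set.uIcc_of_ge h0] at h1
        exact hxy.trans h1.1
    | up => exact hx.elim (fun h => hxy.trans h.1) (fun h => h.2 y hy)
    | down => exact hx.elim (fun h => h.2 y hy hxy) (fun h => hxy.trans h.1.le)

/-- `F` has the largest element `M` and contains the numbers that the simulation needs: small
integers, small negative powers of two, and numbers that agree with `M / 2 ^ j` up to a factor of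
at most two. -/
structure HasRange (F : Set ℝ) (q : ℕ) (M : ℝ) : Prop where
  max_mem : M ∈ F
  le_max : ∀ x ∈ F, x ≤ M
  two_le : 2 ≤ M
  int_mem : ∀ k : ℤ, |k| ≤ 2 ^ (q + 2) → (k : ℝ) ∈ F
  inv_mem : ∀ j ≤ q + 2, (1 / 2 ^ j : ℝ) ∈ F
  scale : ∀ j ≤ q, ∃ y ∈ F, y * 2 ^ j ≤ M ∧ M ≤ y * 2 ^ (j + 1)

namespace FormatKind

/-- Here `M` is `2 ^ (q + 4)` minus one unit in the last place, so powers of two just below it serve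
as the approximations to `M / 2 ^ j`. -/
theorem hasRange_fixedPoint (q : ℕ) :
    HasRange (fixedPoint.values (q + 4) (q + 4)) q
      (((2 ^ (q + 4 + (q + 4)) - 1 : ℤ) : ℝ) / 2 ^ (q + 4)) := by
  have hb : (0 : ℝ) < 2 ^ (q + 4) := by positivity
  have hq : (1 : ℝ) ≤ 2 ^ q := one_le_pow₀ (by norm_num)
  have hqz : (1 : ℤ) ≤ 2 ^ q := one_le_pow₀ (by norm_num)
  refine ⟨⟨_, ?_, rfl⟩, ?_, ?_, ?_, ?_, ?_⟩
  · rw [abs_of_nonneg] <;> [skip; rw [sub_nonneg]] <;> [linarith; exact one_le_pow₀ (by norm_num)]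
  · rintro x ⟨k, hk, rfl⟩
    gcongr
    have := (le_abs_self k).trans_lt hk
    linarith [Int.le_sub_one_of_lt this]
  · rw [le_div_iff₀ hb]
    push_cast
    rw [pow_add 2 (q + 4) (q + 4), pow_add]
    nlinarith
  · intro k hk
    refine ⟨k * 2 ^ (q + 4), ?_, ?_⟩
    · rw [abs_mul, abs_of_pos (show (0 : ℤ) < 2 ^ (q + 4) by positivity),
        pow_add 2 (q + 4) (q + 4)]
      have : |k| < 2 ^ (q + 4) := hk.trans_lt (pow_lt_pow_right₀ (by norm_num) (by lia))
      gcongr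
    · push_cast
      field_simp
  · intro j hj
    refine ⟨2 ^ (q + 4 - j), ?_, ?_⟩
    · rw [abs_of_pos (by positivity)]
      exact pow_lt_pow_right₀ (by norm_num) (by lia)
    · push_cast
      rw [div_eq_div_iff (by positivity) (by positivity), ← pow_add, Nat.sub_add_cancel (by lia),
        one_mul]
  · intro j hj
    refine ⟨2 ^ (q + 3 - j), ⟨2 ^ (q + 3 - j + (q + 4)), ?_, ?_⟩, ?_, ?_⟩
    · rw [abs_of_pos (by positivity)]
      exact pow_lt_pow_right₀ (by norm_num) (by lia)
    · push_cast
      rw [pow_add 2 (q + 3 - j) (q + 4)]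
      field_simp
    · rw [← pow_add, Nat.sub_add_cancel (by lia), le_div_iff₀ hb]
      push_cast
      rw [pow_add 2 (q + 4) (q + 4), pow_add, pow_add]
      nlinarith
    · rw [← pow_add, show q + 3 - j + (j + 1) = q + 4 by lia, div_le_iff₀ hb]
      push_cast
      rw [pow_add 2 (q + 4) (q + 4)]
      linarith

theorem hasRange_floatingPoint (q : ℕ) :
    HasRange (floatingPoint.values (q + 4) (q + 4)) q
      (((2 ^ (q + 4) - 1 : ℤ) : ℝ) * (2 : ℝ) ^ ((2 ^ (q + 4) - 1 : ℤ))) := by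
  have hq : (1 : ℝ) ≤ 2 ^ q := one_le_pow₀ (by norm_num)
  have hqz : (1 : ℤ) ≤ 2 ^ q := one_le_pow₀ (by norm_num)
  have hz : (1 : ℤ) ≤ 2 ^ (q + 4) := one_le_pow₀ (by norm_num)
  have habs : |(2 ^ (q + 4) - 1 : ℤ)| < 2 ^ (q + 4) := by
    rw [abs_of_nonneg (by linarith)]; linarith
  have hE : (1 : ℝ) ≤ (2 : ℝ) ^ ((2 ^ (q + 4) - 1 : ℤ)) :=
    one_le_zpow₀ (by norm_num) (by linarith)
  refine ⟨⟨_, _, habs, habs, rfl⟩, ?_, ?_, ?_, ?_, ?_⟩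
  · rintro x ⟨m, e, hm, he, rfl⟩
    have hm' : m ≤ 2 ^ (q + 4) - 1 := by linarith [Int.le_sub_one_of_lt ((le_abs_self m).trans_lt hm)]
    have he' : e ≤ 2 ^ (q + 4) - 1 := by linarith [Int.le_sub_one_of_lt ((le_abs_self e).trans_lt he)]
    have h1 : (m : ℝ) ≤ ((2 ^ (q + 4) - 1 : ℤ) : ℝ) := by exact_mod_cast hm'
    have h2 : (2 : ℝ) ^ e ≤ (2 : ℝ) ^ ((2 ^ (q + 4) - 1 : ℤ)) :=
      zpow_le_zpow_right₀ (by norm_num) he'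
    have h3 : (0 : ℝ) ≤ ((2 ^ (q + 4) - 1 : ℤ) : ℝ) := Int.cast_nonneg (by linarith)
    exact mul_le_mul h1 h2 (by positivity) h3
  · have : (2 : ℝ) ≤ ((2 ^ (q + 4) - 1 : ℤ) : ℝ) := by
      push_cast
      rw [pow_add]
      linarith
    nlinarith
  · intro k hk
    exact ⟨k, 0, hk.trans_lt (pow_lt_pow_right₀ (by norm_num) (by lia)), by simp, by simp⟩
  · intro j hj
    refine ⟨1, -j, ?_, ?_, ?_⟩
    · simpa using one_lt_pow₀ (one_lt_two (α := ℤ)) (by lia : q + 4 ≠ 0)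
    · rw [abs_neg, abs_of_nonneg (by positivity)]
      have : q + 4 < 2 ^ (q + 4) := Nat.lt_two_pow_self
      have : j < 2 ^ (q + 4) := by lia
      exact_mod_cast this
    · simp
  · intro j hj
    have hE0 := zero_le_one.trans hE
    -- Keep the top exponent of `M` and shrink the mantissa, which is just below `2 ^ (q + 4)`, to a
    -- power of two.
    refine ⟨2 ^ (q + 3 - j) * (2 : ℝ) ^ ((2 ^ (q + 4) - 1 : ℤ)),
      ⟨2 ^ (q + 3 - j), _, ?_, habs, by push_cast; rfl⟩, ?_, ?_⟩
    · rw [abs_of_pos (by positivity)]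
      exact pow_lt_pow_right₀ (by norm_num) (by lia)
    · rw [mul_right_comm, ← pow_add, Nat.sub_add_cancel (by lia)]
      gcongr
      push_cast
      rw [pow_add, pow_add]
      linarith
    · rw [mul_right_comm, ← pow_add, show q + 3 - j + (j + 1) = q + 4 by lia]
      gcongr
      push_cast
      linarith

theorem exists_hasRange (κ : FormatKind) (q : ℕ) :
    ∃ M, HasRange (κ.values (q + 4) (q + 4)) q M := by
  cases κ
  · exact ⟨_, hasRange_fixedPoint q⟩
  · exact ⟨_, hasRange_floatingPoint q⟩

end FormatKind

namespace HasRange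

variable {F : Set ℝ} {q : ℕ} {M : ℝ}

theorem zero_mem (h : HasRange F q M) : (0 : ℝ) ∈ F := by
  exact_mod_cast h.int_mem 0 (by positivity)

theorem one_mem (h : HasRange F q M) : (1 : ℝ) ∈ F := by
  exact_mod_cast h.int_mem 1 (by simpa using one_le_pow₀ (one_le_two (α := ℤ)))

theorem neg_one_mem (h : HasRange F q M) : (-1 : ℝ) ∈ F := by
  exact_mod_cast h.int_mem (-1) (by simpa using one_le_pow₀ (one_le_two (α := ℤ)))

theorem natCast_mem (h : HasRange F q M) {k : ℕ} (hk : k ≤ 2 ^ (q + 2)) : (k : ℝ) ∈ F := by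
  exact_mod_cast h.int_mem k (by rw [abs_of_nonneg (by positivity)]; exact_mod_cast hk)

theorem nonneg (h : HasRange F q M) : 0 ≤ M := by linarith [h.two_le]

end HasRange

namespace RoundsInto

variable {F : Set ℝ} {ρ : ℝ → ℝ} {q : ℕ} {M : ℝ}

theorem eq_self (h : RoundsInto F ρ) {x : ℝ} (hx : x ∈ F) : ρ x = x :=
  le_antisymm (h.le_of_le hx le_rfl) (h.ge_of_ge hx le_rfl)

theorem zero (h : RoundsInto F ρ) (hF : HasRange F q M) : ρ 0 = 0 := h.eq_self hF.zero_mem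

theorem eq_max (h : RoundsInto F ρ) (hF : HasRange F q M) {x : ℝ} (hx : M ≤ x) : ρ x = M :=
  le_antisymm (hF.le_max _ (h.mem x)) (h.ge_of_ge hF.max_mem hx)

/-- Some `y ∈ F` lies between `M / 2 ^ (j + 1)` and `M / 2 ^ j`; truncating `x` cannot take it below
`y`, so the product reaches `M` and saturates. -/
theorem scale_up (h : RoundsInto F ρ) (hF : HasRange F q M) {j : ℕ} (hj : j ≤ q) {x : ℝ}
    (hx : M ≤ x * 2 ^ j) : ρ (ρ x * 2 ^ (j + 1)) = M := by
  obtain ⟨y, hy, h1, h2⟩ := hF.scale j hj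
  have hyx : y ≤ x := le_of_mul_le_mul_right (h1.trans hx) (by positivity)
  refine h.eq_max hF (h2.trans ?_)
  gcongr
  exact h.ge_of_ge hy hyx

end RoundsInto

/-! ### The activation function -/

theorem gelu_zero : gelu 0 = 0 := by simp [gelu]

theorem half_le_cdf_gaussianReal {x : ℝ} (hx : 0 ≤ x) :
    1 / 2 ≤ ProbabilityTheory.cdf (ProbabilityTheory.gaussianReal 0 1) x := by
  set μ := ProbabilityTheory.gaussianReal 0 1 with hμ
  refine le_trans ?_ (ProbabilityTheory.monotone_cdf μ hx)
  rw [ProbabilityTheory.cdf_eq_real]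
  -- By symmetry both closed half-lines have the same mass, and together they cover the line.
  have hsymm : μ.real (Set.Ici 0) = μ.real (Set.Iic 0) := by
    have hmap : μ.map (fun x => -x) = μ := by
      rw [hμ, ProbabilityTheory.gaussianReal_map_neg, neg_zero]
    conv_lhs => rw [← hmap]
    rw [MeasureTheory.map_measureReal_apply measurable_neg measurableSet_Ici]
    congr 1
    ext x
    simp
  have hcover : μ.real Set.univ ≤ μ.real (Set.Iic 0) + μ.real (Set.Ici 0) := by
    rw [← Set.Iic_union_Ici (a := (0 : ℝ))]
    exact MeasureTheory.measureReal_union_le _ _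
  rw [MeasureTheory.probReal_univ] at hcover
  linarith

theorem half_le_gelu {x : ℝ} (hx : 0 ≤ x) : x / 2 ≤ gelu x := by
  have := mul_le_mul_of_nonneg_left (half_le_cdf_gaussianReal hx) hx
  rw [gelu]
  linarith

/-! ### Polynomial and logarithmic growth -/

theorem Polynomial.exists_eval_le_pow (p : Polynomial ℕ) :
    ∃ k : ℕ, ∀ n, 2 ≤ n → p.eval n ≤ n ^ k := by
  -- Coefficients are absorbed into the exponent, as is the factor 2 from each addition.
  have hC : ∀ a : ℕ, ∀ n, 2 ≤ n → a ≤ n ^ a := fun a n hn =>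
    Nat.lt_two_pow_self.le.trans (Nat.pow_le_pow_left hn a)
  induction p using Polynomial.induction_on' with
  | add p p' hp hp' =>
    obtain ⟨k, hk⟩ := hp
    obtain ⟨k', hk'⟩ := hp'
    refine ⟨k + k' + 1, fun n hn => ?_⟩
    have h1 : n ^ k ≤ n ^ (k + k') := Nat.pow_le_pow_right (by lia) (by lia)
    have h2 : n ^ k' ≤ n ^ (k + k') := Nat.pow_le_pow_right (by lia) (by lia)
    have h3 : n ^ (k + k') * 2 ≤ n ^ (k + k') * n := Nat.mul_le_mul_left _ hn
    rw [Polynomial.eval_add, pow_succ]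
    linarith [hk n hn, hk' n hn]
  | monomial m a =>
    refine ⟨a + m, fun n hn => ?_⟩
    rw [Polynomial.eval_monomial, pow_add]
    exact Nat.mul_le_mul_right _ (hC a n hn)

theorem PolyBounded.logBounded_log {f : ℕ → ℕ} (hf : PolyBounded f) (c d : ℕ) :
    LogBounded fun n => c * Nat.log 2 (f n) + d := by
  obtain ⟨p, hp⟩ := hf
  obtain ⟨k, hk⟩ := p.exists_eval_le_pow
  have hlog2 : 0 < Real.log 2 := Real.log_pos one_lt_two
  refine IsBigO.of_bound ((c * k + d) / Real.log 2) ?_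
  filter_upwards [Filter.eventually_ge_atTop 2] with n hn
  have hn' : (2 : ℝ) ≤ n := by exact_mod_cast hn
  have hlog : Real.log 2 ≤ Real.log n := Real.log_le_log two_pos hn'
  have hbound : (Nat.log 2 (f n) : ℝ) ≤ k * (Real.log n / Real.log 2) := by
    have h1 : Nat.log 2 (f n) ≤ Nat.log 2 (n ^ k) :=
      Nat.log_mono_right ((hp n).trans (hk n hn))
    have h2 : (Nat.log 2 (n ^ k) : ℝ) ≤ Real.logb 2 ((n ^ k : ℕ) : ℝ) := by
      exact_mod_cast Real.natLog_le_logb (n ^ k) 2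
    rw [Nat.cast_pow, Real.logb_pow] at h2
    exact (Nat.cast_le.2 h1).trans h2
  have hone : 1 ≤ Real.log n / Real.log 2 := (one_le_div hlog2).2 hlog
  rw [Real.norm_of_nonneg (by positivity), Real.norm_of_nonneg (by linarith)]
  push_cast
  calc (c : ℝ) * Nat.log 2 (f n) + d
      ≤ c * (k * (Real.log n / Real.log 2)) + d * (Real.log n / Real.log 2) := by
        gcongr
        exact le_mul_of_one_le_right (by positivity) hone
    _ = (c * k + d) / Real.log 2 * Real.log n := by ring

/-! ### Gates as disjunctions of literals -/

namespace BoolCircuit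

variable {n : ℕ} (C : BoolCircuit n)

/-- The gates that gate `g` reads. -/
def fanin (g : Fin C.size) : Finset (Fin C.size) :=
  match C.gate g with
  | .input _ => ∅
  | .not j => {⟨j, j.isLt.trans g.isLt⟩}
  | .and s => s.map (Fin.castLEEmb g.isLt.le)
  | .or s => s.map (Fin.castLEEmb g.isLt.le)

/-- Whether gate `g` is a conjunction; the simulation stores the negated values of these gates. -/
def isAnd (g : Fin C.size) : Bool :=
  match C.gate g with
  | .and _ => true
  | _ => false

/-- Whether the stored value of gate `g` is the disjunction of the negated values of its inputs. -/
def negatesFanin (g : Fin C.size) : Bool :=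
  match C.gate g with
  | .input _ => false
  | .not _ => true
  | .and _ => true
  | .or _ => false

/-- The value of gate `g` in the form in which the simulation stores it. -/
def stored (x : Fin n → Bool) (g : Fin C.size) : Bool := C.val x g ^^ C.isAnd g

/-- Whether gate `g` reads the stored value of gate `j` negated. -/
def negLit (g j : Fin C.size) : Bool := C.isAnd j ^^ C.negatesFanin g

/-- Whether gate `g` is the input gate for the bit `i`. -/
def readsInput (g : Fin C.size) (i : Fin n) : Bool :=
  match C.gate g with
  | .input k => decide (k = i)
  | _ => false

theorem readsInput_of_input {g : Fin C.size} {k : Fin n} (h : C.gate g = .input k) (i : Fin n) :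
    C.readsInput g i = decide (k = i) := by
  rw [readsInput, h]

theorem readsInput_eq_false {g : Fin C.size} (h : ¬∃ k, C.gate g = .input k) (i : Fin n) :
    C.readsInput g i = false := by
  rw [readsInput]
  split
  · exact absurd ⟨_, ‹_›⟩ h
  · rfl

theorem gateDepth_eq_zero_iff (g : Fin C.size) :
    C.gateDepth g = 0 ↔ ∃ i, C.gate g = .input i := by
  rw [gateDepth]
  cases C.gate g <;> simp

theorem stored_of_input {x : Fin n → Bool} {g : Fin C.size} {i : Fin n}
    (h : C.gate g = .input i) : C.stored x g = x i := by
  rw [stored, val, isAnd, h]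
  simp

theorem gateDepth_lt_of_mem_fanin {g j : Fin C.size} (h : j ∈ C.fanin g) :
    C.gateDepth j < C.gateDepth g := by
  rw [gateDepth.eq_def C g]
  rw [fanin] at h
  cases hg : C.gate g with
  | input i => simp [hg] at h
  | not k =>
    simp only [hg, Finset.mem_singleton] at h
    subst h
    exact Nat.lt_succ_self _
  | and s =>
    simp only [hg, Finset.mem_map] at h
    obtain ⟨k, hk, rfl⟩ := h
    exact Nat.lt_succ_of_le
      (Finset.le_sup (f := fun j : Fin g => C.gateDepth ⟨j, j.isLt.trans g.isLt⟩) hk)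
  | or s =>
    simp only [hg, Finset.mem_map] at h
    obtain ⟨k, hk, rfl⟩ := h
    exact Nat.lt_succ_of_le
      (Finset.le_sup (f := fun j : Fin g => C.gateDepth ⟨j, j.isLt.trans g.isLt⟩) hk)

/-- De Morgan: a negated AND is the OR of the negated inputs, and a NOT is a one-literal OR.
`negLit` combines this negation with the one already present in the stored input. -/
theorem stored_eq_true_iff {x : Fin n → Bool} {g : Fin C.size} (h : C.gateDepth g ≠ 0) :
    C.stored x g = true ↔ ∃ j ∈ C.fanin g, (C.stored x j ^^ C.negLit g j) = true := by
  have hlit : ∀ j, (C.stored x j ^^ C.negLit g j) = (C.val x j ^^ C.negatesFanin g) := by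
    intro j
    rw [stored, negLit]
    cases C.val x j <;> cases C.isAnd j <;> simp
  simp only [hlit]
  rw [stored, val.eq_def C x g, isAnd, negatesFanin, fanin]
  cases hg : C.gate g with
  | input i => exact absurd ((C.gateDepth_eq_zero_iff g).2 ⟨i, hg⟩) h
  | not k => simp
  | and s => simp [Fin.castLE]
  | or s => simp [Fin.castLE]

end BoolCircuit

/-! ### Coordinates of the hidden states -/

/-- The coordinates of the hidden states that simulate a circuit with `S` gates: a constant, and
for every gate a source coordinate, through which input bits enter, and a target coordinate, which
receives the stored value of the gate. -/
abbrev Coord (S : ℕ) : Type := Unit ⊕ (Fin S ⊕ Fin S)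

namespace Coord

abbrev const {S : ℕ} : Coord S := .inl ()

abbrev src {S : ℕ} (g : Fin S) : Coord S := .inr (.inl g)

abbrev tgt {S : ℕ} (g : Fin S) : Coord S := .inr (.inr g)

theorem card_eq (S : ℕ) : Fintype.card (Coord S) = 2 * S + 1 := by
  simp
  ring

/-- The place of a coordinate in the single attention head. -/
noncomputable def headEquiv (S : ℕ) : Coord S ≃ Fin (2 * S + 1) :=
  Fintype.equivFinOfCardEq (card_eq S)

/-- The place of a coordinate in the hidden state. -/
noncomputable def hiddenEquiv (S : ℕ) : Coord S ≃ Fin (1 * (2 * S + 1)) :=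
  Fintype.equivFinOfCardEq (by rw [card_eq, one_mul])

theorem sum_hidden {S : ℕ} (f : Fin (1 * (2 * S + 1)) → ℝ) :
    ∑ e, f e = f (hiddenEquiv S const) +
      (∑ g, f (hiddenEquiv S (src g)) + ∑ g, f (hiddenEquiv S (tgt g))) := by
  rw [← Equiv.sum_comp (hiddenEquiv S), Fintype.sum_sum_type, Fintype.sum_sum_type]
  simp

theorem sum_head {S : ℕ} (f : Fin (2 * S + 1) → ℝ) :
    ∑ e, f e = f (headEquiv S const) +
      (∑ g, f (headEquiv S (src g)) + ∑ g, f (headEquiv S (tgt g))) := by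
  rw [← Equiv.sum_comp (headEquiv S), Fintype.sum_sum_type, Fintype.sum_sum_type]
  simp

end Coord

open Coord

/-! ### The layers -/

namespace BoolCircuit

variable {n : ℕ} (C : BoolCircuit n)

/-- The value matrix of the attention layer: the target coordinate of a gate receives the
difference of the constant and the source coordinate. -/
def valueWeight : Coord C.size → Coord C.size → ℝ
  | .inl _, .inr (.inr _) => 1
  | .inr (.inl g'), .inr (.inr g) => if g' = g then -1 else 0
  | _, _ => 0

/-- The output matrix of the attention layer, a multiple of the projection to the target
coordinates. -/
def outWeight (K : ℝ) : Coord C.size → Coord C.size → ℝ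
  | .inr (.inr g'), .inr (.inr g) => if g' = g then K else 0
  | _, _ => 0

/-- The first feed-forward matrix: it adds up the literals that a gate reads. -/
def literalWeight : Coord C.size → Coord C.size → ℝ
  | .inl _, .inr (.inr g) => (((C.fanin g).filter fun j => C.negLit g j = true).card : ℝ)
  | .inr (.inr j), .inr (.inr g) => if j ∈ C.fanin g then if C.negLit g j then -1 else 1 else 0
  | _, _ => 0

/-- The second feed-forward matrix: it writes the gates of depth `l`. -/
def writeWeight (l : ℕ) : Coord C.size → Coord C.size → ℝ
  | .inr (.inr g'), .inr (.inr g) => if g' = g then if C.gateDepth g = l then 4 else 0 else 0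
  | _, _ => 0

/-- The layer that copies all input bits to the last position by uniform attention. -/
noncomputable def gatherLayer (q : ℕ) : TransformerLayer 1 (2 * C.size + 1) where
  Wq _ _ _ := 0
  Wk _ _ _ := 0
  Wv _ e c := C.valueWeight ((hiddenEquiv _).symm e) ((headEquiv _).symm c)
  Wo _ c e := C.outWeight (2 ^ (q + 1)) ((headEquiv _).symm c) ((hiddenEquiv _).symm e)
  W₁ _ _ := 0
  b₁ _ := 0
  W₂ _ _ := 0

/-- The layer that computes the gates of depth `l`, without attention. -/
noncomputable def gateLayer (l : ℕ) : TransformerLayer 1 (2 * C.size + 1) where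
  Wq _ _ _ := 0
  Wk _ _ _ := 0
  Wv _ _ _ := 0
  Wo _ _ _ := 0
  W₁ e e' := C.literalWeight ((hiddenEquiv _).symm e) ((hiddenEquiv _).symm e')
  b₁ _ := 0
  W₂ e e' := C.writeWeight l ((hiddenEquiv _).symm e) ((hiddenEquiv _).symm e')

theorem gatherLayer_paramsIn {F : Set ℝ} {q : ℕ} {M : ℝ} (hF : HasRange F q M) :
    (C.gatherLayer q).ParamsIn F := by
  have h0 := hF.zero_mem
  have hK : (2 ^ (q + 1) : ℝ) ∈ F := by
    exact_mod_cast hF.natCast_mem (Nat.pow_le_pow_right two_pos (by lia : q + 1 ≤ q + 2))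
  have hV : ∀ c c', C.valueWeight c c' ∈ F := by
    intro c c'
    unfold valueWeight
    split
    · exact hF.one_mem
    · split_ifs
      · exact hF.neg_one_mem
      · exact h0
    · exact h0
  have hO : ∀ c c', C.outWeight (2 ^ (q + 1)) c c' ∈ F := by
    intro c c'
    unfold outWeight
    split
    · split_ifs
      · exact hK
      · exact h0
    · exact h0
  exact ⟨fun _ _ _ => h0, fun _ _ _ => h0, fun _ _ _ => hV _ _, fun _ _ _ => hO _ _,
    fun _ _ => h0, fun _ => h0, fun _ _ => h0⟩

theorem gateLayer_paramsIn {F : Set ℝ} {q : ℕ} {M : ℝ} (hF : HasRange F q M)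
    (hS : C.size ≤ 2 ^ q) (l : ℕ) : (C.gateLayer l).ParamsIn F := by
  have h0 := hF.zero_mem
  have h4 : (4 : ℝ) ∈ F := by
    exact_mod_cast hF.natCast_mem (Nat.pow_le_pow_right two_pos (by lia : 2 ≤ q + 2))
  have h1 : ∀ c c', C.literalWeight c c' ∈ F := by
    intro c c'
    unfold literalWeight
    split
    · refine hF.natCast_mem ((Finset.card_le_univ _).trans ?_)
      rw [Fintype.card_fin]
      exact hS.trans (Nat.pow_le_pow_right two_pos (by lia))
    · split_ifs
      · exact hF.neg_one_mem
      · exact hF.one_mem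
      · exact h0
    · exact h0
  have h2 : ∀ c c', C.writeWeight l c c' ∈ F := by
    intro c c'
    unfold writeWeight
    split
    · split_ifs
      · exact h4
      · exact h0
      · exact h0
    · exact h0
  exact ⟨fun _ _ _ => h0, fun _ _ _ => h0, fun _ _ _ => h0, fun _ _ _ => h0,
    fun _ _ => h1 _ _, fun _ => h0, fun _ _ => h2 _ _⟩

/-! ### The forward pass -/

/-- The truth values are represented by the numbers `0` and `M`. -/
def enc (M : ℝ) (v : Bool) : ℝ := if v then M else 0

/-- The hidden state `x` holds the stored values of the gates of depth at most `l`. -/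
structure Holds (M : ℝ) (s : Fin n → Bool) (l : ℕ) (x : Fin (1 * (2 * C.size + 1)) → ℝ) :
    Prop where
  const : x (hiddenEquiv _ const) = M
  tgt : ∀ g, x (hiddenEquiv _ (tgt g)) = if C.gateDepth g ≤ l then enc M (C.stored s g) else 0

/-- The hidden states that the embedding produces. -/
structure IsInitial (M : ℝ) (s : Fin n → Bool) (X : Fin n → Fin (1 * (2 * C.size + 1)) → ℝ) :
    Prop where
  const : ∀ j, X j (hiddenEquiv _ const) = M
  src : ∀ j g, M - X j (hiddenEquiv _ (src g)) = enc M (C.readsInput g j && s j)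
  tgt : ∀ j g, X j (hiddenEquiv _ (tgt g)) = 0

variable {F : Set ℝ} {ρ : ℝ → ℝ} {q : ℕ} {M : ℝ}

theorem enc_mem (hF : HasRange F q M) (v : Bool) : enc M v ∈ F := by
  cases v
  · exact hF.zero_mem
  · exact hF.max_mem

/-- Zero queries and keys make all scores equal, so attention is uniform over the visible positions.
-/
theorem gatherLayer_weight (hρ : RoundsInto F ρ) (hF : HasRange F q M)
    (X : Fin n → Fin (1 * (2 * C.size + 1)) → ℝ) (h : Fin 1) (i j : Fin n) :
    (C.gatherLayer q).weight ρ X h i j = ρ (1 / ((i : ℕ) + 1 : ℝ)) := by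
  simp [TransformerLayer.weight, TransformerLayer.score, TransformerLayer.linear, gatherLayer,
    hρ.zero hF]

theorem gatherLayer_head_tgt (hρ : RoundsInto F ρ) (hF : HasRange F q M) {s : Fin n → Bool}
    {X : Fin n → Fin (1 * (2 * C.size + 1)) → ℝ} (hX : C.IsInitial M s X) {i : Fin n}
    (hi : i.val + 1 = n) (h : Fin 1) (g : Fin C.size) :
    (C.gatherLayer q).head ρ X h i (headEquiv _ (tgt g)) =
      ρ (ρ (1 / (n : ℝ)) * if C.gateDepth g ≤ 0 then enc M (C.stored s g) else 0) := by
  have hv : ∀ j, TransformerLayer.linear ρ (X j) ((C.gatherLayer q).Wv h) (headEquiv _ (tgt g)) =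
      enc M (C.readsInput g j && s j) := by
    intro j
    rw [← hρ.eq_self (enc_mem hF _), ← hX.src j g, TransformerLayer.linear, sum_hidden]
    simp [gatherLayer, valueWeight, hX.const, sub_eq_add_neg]
  have hn : ((i : ℕ) : ℝ) + 1 = n := by exact_mod_cast hi
  simp only [TransformerLayer.head, gatherLayer_weight C hρ hF, hv, ← Finset.mul_sum, hn]
  congr 2
  by_cases hg : ∃ k, C.gate g = .input k
  · rw [if_pos ((C.gateDepth_eq_zero_iff g).2 hg).le]
    obtain ⟨k, hk⟩ := hg
    -- Only the position that the input gate reads contributes; the last position sees it despite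
    -- the causal mask.
    rw [Finset.sum_eq_single k, C.stored_of_input hk]
    · simp [C.readsInput_of_input hk]
    · intro j _ hj
      simp [C.readsInput_of_input hk, enc, hj.symm]
    · intro hk'
      exact absurd (Finset.mem_Iic.2 (Fin.le_def.2 (by lia))) hk'
  · rw [if_neg (by rwa [Nat.le_zero, C.gateDepth_eq_zero_iff])]
    refine Finset.sum_eq_zero fun j _ => ?_
    simp [C.readsInput_eq_false hg, enc]

theorem gatherLayer_multiHead_const (hρ : RoundsInto F ρ) (hF : HasRange F q M)
    (X : Fin n → Fin (1 * (2 * C.size + 1)) → ℝ) (i : Fin n) :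
    (C.gatherLayer q).multiHead ρ X i (hiddenEquiv _ const) = 0 := by
  simp [TransformerLayer.multiHead, gatherLayer, outWeight, hρ.zero hF]

theorem gatherLayer_multiHead_tgt (hρ : RoundsInto F ρ) (hF : HasRange F q M) (hnq : n ≤ 2 ^ q)
    {s : Fin n → Bool} {X : Fin n → Fin (1 * (2 * C.size + 1)) → ℝ} (hX : C.IsInitial M s X)
    {i : Fin n} (hi : i.val + 1 = n) (g : Fin C.size) :
    (C.gatherLayer q).multiHead ρ X i (hiddenEquiv _ (tgt g)) =
      if C.gateDepth g ≤ 0 then enc M (C.stored s g) else 0 := by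
  have hsum : (C.gatherLayer q).multiHead ρ X i (hiddenEquiv _ (tgt g)) =
      ρ ((C.gatherLayer q).head ρ X 0 i (headEquiv _ (tgt g)) * 2 ^ (q + 1)) := by
    rw [TransformerLayer.multiHead, Fin.sum_univ_one, sum_head]
    congr 1
    simp [gatherLayer, outWeight]
  rw [hsum, gatherLayer_head_tgt C hρ hF hX hi]
  by_cases h : C.gateDepth g ≤ 0 ∧ C.stored s g = true
  · simp only [h.1, h.2, enc, if_true]
    refine hρ.scale_up hF le_rfl ?_
    have hn : (0 : ℝ) < n := by exact_mod_cast (by lia : 0 < n)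
    -- The rounded weight is only bounded below, by an element of `F`. This suffices for the factor
    -- `2 ^ (q + 1)` in the output matrix to restore `M`.
    have hw : (1 / 2 ^ q : ℝ) ≤ ρ (1 / (n : ℝ)) := by
      refine hρ.ge_of_ge (hF.inv_mem q (by lia)) ?_
      gcongr
      exact_mod_cast hnq
    have := mul_le_mul_of_nonneg_right hw (by positivity : (0 : ℝ) ≤ 2 ^ q)
    rw [one_div, inv_mul_cancel₀ (by positivity)] at this
    rw [mul_right_comm]
    exact le_mul_of_one_le_left hF.nonneg this
  · have h0 : (if C.gateDepth g ≤ 0 then enc M (C.stored s g) else 0) = 0 := by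
      split_ifs with hd
      · rw [enc, if_neg fun hs => h ⟨hd, hs⟩]
      · rfl
    rw [h0, mul_zero, hρ.zero hF, zero_mul, hρ.zero hF]

theorem gatherLayer_forward (hρ : RoundsInto F ρ) (hF : HasRange F q M) (hnq : n ≤ 2 ^ q)
    {s : Fin n → Bool} {X : Fin n → Fin (1 * (2 * C.size + 1)) → ℝ} (hX : C.IsInitial M s X)
    {i : Fin n} (hi : i.val + 1 = n) : C.Holds M s 0 ((C.gatherLayer q).forward ρ X i) := by
  have hffn : ∀ x e, (C.gatherLayer q).ffn ρ x e = 0 := by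
    intro x e
    simp [TransformerLayer.ffn, TransformerLayer.linear, gatherLayer, hρ.zero hF]
  constructor
  · rw [TransformerLayer.forward, hffn, add_zero, TransformerLayer.attention,
      C.gatherLayer_multiHead_const hρ hF, zero_add, hX.const, hρ.eq_self hF.max_mem,
      hρ.eq_self hF.max_mem]
  · intro g
    have hm : (if C.gateDepth g ≤ 0 then enc M (C.stored s g) else 0) ∈ F := by
      split_ifs
      · exact enc_mem hF _
      · exact hF.zero_mem
    rw [TransformerLayer.forward, hffn, add_zero, TransformerLayer.attention,
      C.gatherLayer_multiHead_tgt hρ hF hnq hX hi, hX.tgt, add_zero, hρ.eq_self hm, hρ.eq_self hm]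

theorem gateLayer_attention (hρ : RoundsInto F ρ) (hF : HasRange F q M) (l : ℕ)
    (X : Fin n → Fin (1 * (2 * C.size + 1)) → ℝ) (i : Fin n) (e : Fin (1 * (2 * C.size + 1))) :
    (C.gateLayer l).attention ρ X i e = ρ (X i e) := by
  simp [TransformerLayer.attention, TransformerLayer.multiHead, gateLayer, hρ.zero hF]

/-- Each negated literal is `M` minus the stored value; the copies of `M` are collected in the
weight of the constant coordinate. The sum is exact because truncation comes only after it. -/
theorem sum_literalWeight {s : Fin n → Bool} {l : ℕ} {x : Fin (1 * (2 * C.size + 1)) → ℝ}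
    (hx : C.Holds M s l x) {g : Fin C.size} (hg : C.gateDepth g = l + 1) :
    ∑ e, x e * (C.gateLayer (l + 1)).W₁ e (hiddenEquiv _ (tgt g)) =
      ∑ j ∈ C.fanin g, enc M (C.stored s j ^^ C.negLit g j) := by
  rw [sum_hidden]
  simp only [gateLayer, Equiv.symm_apply_apply, literalWeight, hx.const, mul_zero,
    Finset.sum_const_zero, zero_add, mul_ite]
  rw [Finset.sum_ite_mem, Finset.univ_inter, Finset.card_filter, Nat.cast_sum, Finset.mul_sum,
    ← Finset.sum_add_distrib]
  refine Finset.sum_congr rfl fun j hj => ?_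
  have hj' : C.gateDepth j ≤ l := by
    have := C.gateDepth_lt_of_mem_fanin hj
    lia
  rw [hx.tgt, if_pos hj']
  cases C.stored s j <;> cases C.negLit g j <;> simp [enc]

theorem round_sum_enc (hρ : RoundsInto F ρ) (hF : HasRange F q M) {ι : Type*} (t : Finset ι)
    (v : ι → Bool) [Decidable (∃ j ∈ t, v j = true)] :
    ρ (∑ j ∈ t, enc M (v j)) = enc M (decide (∃ j ∈ t, v j = true)) := by
  have henc : ∀ b, 0 ≤ enc M b := by
    intro b
    cases b
    · exact le_rfl
    · exact hF.nonneg
  by_cases h : ∃ j ∈ t, v j = true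
  · rw [decide_eq_true h]
    obtain ⟨j, hj, hv⟩ := h
    refine hρ.eq_max hF ?_
    have := Finset.single_le_sum (f := fun j => enc M (v j)) (fun j _ => henc _) hj
    simpa [enc, hv] using this
  · rw [decide_eq_false h, Finset.sum_eq_zero]
    · exact hρ.zero hF
    · intro j hj
      rw [enc, if_neg fun hv => h ⟨j, hj, hv⟩]

/-- GeLU fixes 0 and keeps at least half of `M`; the factor 4 consists of 2 for that half and 2 for
the truncation. -/
theorem amplify_gelu_enc (hρ : RoundsInto F ρ) (hF : HasRange F q M) (hq : 1 ≤ q) (v : Bool) :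
    ρ (ρ (gelu (enc M v)) * 4) = enc M v := by
  cases v
  · simp [enc, gelu_zero, hρ.zero hF]
  · rw [show (4 : ℝ) = 2 ^ (1 + 1) by norm_num]
    refine hρ.scale_up hF hq ?_
    have := half_le_gelu hF.nonneg
    simp only [enc, if_true]
    linarith

theorem gateLayer_forward (hρ : RoundsInto F ρ) (hF : HasRange F q M) (hq : 1 ≤ q)
    {s : Fin n → Bool} {X : Fin n → Fin (1 * (2 * C.size + 1)) → ℝ} {i : Fin n} {l : ℕ}
    (hX : C.Holds M s l (X i)) : C.Holds M s (l + 1) ((C.gateLayer (l + 1)).forward ρ X i) := by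
  have hA : C.Holds M s l ((C.gateLayer (l + 1)).attention ρ X i) := by
    constructor
    · rw [C.gateLayer_attention hρ hF, hX.const, hρ.eq_self hF.max_mem]
    · intro g
      rw [C.gateLayer_attention hρ hF, hX.tgt]
      split_ifs
      · exact hρ.eq_self (enc_mem hF _)
      · exact hρ.zero hF
  constructor
  · have hffn : ∀ x, (C.gateLayer (l + 1)).ffn ρ x (hiddenEquiv _ const) = 0 := by
      intro x
      simp [TransformerLayer.ffn, TransformerLayer.linear, gateLayer, writeWeight, hρ.zero hF]
    rw [TransformerLayer.forward, hffn, add_zero, hA.const, hρ.eq_self hF.max_mem]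
  · intro g
    have hffn : ∀ x, (C.gateLayer (l + 1)).ffn ρ x (hiddenEquiv _ (tgt g)) =
        ρ (ρ (gelu (ρ (∑ e, x e * (C.gateLayer (l + 1)).W₁ e (hiddenEquiv _ (tgt g))))) *
          if C.gateDepth g = l + 1 then 4 else 0) := by
      intro x
      rw [TransformerLayer.ffn, TransformerLayer.linear, sum_hidden]
      congr 1
      simp [gateLayer, writeWeight]
    rw [TransformerLayer.forward, hffn, hA.tgt]
    -- A gate of the current depth has target 0 so far, so the residual sum just writes its value;
    -- at every other gate `writeWeight` vanishes and the residual preserves the state.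
    by_cases hg : C.gateDepth g = l + 1
    · rw [if_pos hg, C.sum_literalWeight hA hg, round_sum_enc hρ hF, amplify_gelu_enc hρ hF hq,
        if_neg (by lia), if_pos hg.le, zero_add, hρ.eq_self (enc_mem hF _)]
      congr 1
      rw [Bool.eq_iff_iff, decide_eq_true_iff, C.stored_eq_true_iff (by lia)]
    · rw [if_neg hg, mul_zero, hρ.zero hF, add_zero]
      by_cases hl : C.gateDepth g ≤ l
      · rw [if_pos hl, if_pos (by lia), hρ.eq_self (enc_mem hF _)]
      · rw [if_neg hl, if_neg (by lia), hρ.zero hF]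

/-! ### The Transformer -/

/-- The token embedding: a zero bit marks all source coordinates. -/
def tokenWeight (M : ℝ) (t : Bool) : Coord C.size → ℝ
  | .inr (.inl _) => if t then 0 else M
  | _ => 0

/-- The position embedding: it marks the constant and the source coordinates of all gates that do
not read the input bit at this position. -/
def posWeight (M : ℝ) (j : Fin n) : Coord C.size → ℝ
  | .inl _ => M
  | .inr (.inl g) => if C.readsInput g j then 0 else M
  | .inr (.inr _) => 0

/-- The output layer: it reads the literal that says whether the output of the circuit is `t`. -/
def logitWeight (t : Bool) : Coord C.size → ℝ
  | .inl _ => if t = C.isAnd C.output then 1 else 0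
  | .inr (.inl _) => 0
  | .inr (.inr g) => if g = C.output then if t = C.isAnd C.output then -1 else 1 else 0

/-- The Transformer that simulates a circuit of depth at most `D`, in a format with the largest
number `M`. -/
noncomputable def toTransformer (D q : ℕ) (M : ℝ) : Transformer n where
  heads := 1
  headDim := 2 * C.size + 1
  numLayers := D + 1
  embed t e := C.tokenWeight M t ((hiddenEquiv _).symm e)
  pos j e := C.posWeight M j ((hiddenEquiv _).symm e)
  layer l := if l.val = 0 then C.gatherLayer q else C.gateLayer l
  unembed e t := C.logitWeight t ((hiddenEquiv _).symm e)

theorem toTransformer_paramsIn (hF : HasRange F q M) (hS : C.size ≤ 2 ^ q) (D : ℕ) :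
    (C.toTransformer D q M).ParamsIn F := by
  have h0 := hF.zero_mem
  refine ⟨fun t e => ?_, fun j e => ?_, fun l => ?_, fun e t => ?_⟩
  · simp only [toTransformer, tokenWeight]
    split
    · split_ifs
      · exact h0
      · exact hF.max_mem
    · exact h0
  · simp only [toTransformer, posWeight]
    split
    · exact hF.max_mem
    · split_ifs
      · exact h0
      · exact hF.max_mem
    · exact h0
  · simp only [toTransformer]
    split_ifs
    · exact C.gatherLayer_paramsIn hF
    · exact C.gateLayer_paramsIn hF hS l
  · simp only [toTransformer, logitWeight]
    split
    · split_ifs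
      · exact hF.one_mem
      · exact h0
    · exact h0
    · split_ifs
      · exact hF.neg_one_mem
      · exact hF.one_mem
      · exact h0

theorem isInitial_hidden_zero (hρ : RoundsInto F ρ) (hF : HasRange F q M) (D : ℕ)
    (s : Fin n → Bool) :
    C.IsInitial M s ((C.toTransformer D q M).hidden ρ s 0 (Nat.zero_le _)) := by
  constructor
  · intro j
    simp [Transformer.hidden, toTransformer, tokenWeight, posWeight, hρ.eq_self hF.max_mem]
  · intro j g
    -- Token and position embeddings are ORed by saturation: the source is 0 only if the gate reads
    -- this position and the bit is one. If both terms are `M`, their sum overflows back to `M`.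
    cases hg : C.readsInput g j <;> cases hs : s j <;>
      simp [Transformer.hidden, toTransformer, tokenWeight, posWeight, hg, hs, enc, hρ.zero hF,
        hρ.eq_self hF.max_mem, hρ.eq_max hF (show M ≤ M + M by linarith [hF.nonneg])]
  · intro j g
    simp [Transformer.hidden, toTransformer, tokenWeight, posWeight, hρ.zero hF]

/-- Only the last position is followed, since after gathering the attention contributes nothing. -/
theorem holds_hidden (hρ : RoundsInto F ρ) (hF : HasRange F q M) (hq : 1 ≤ q) (hnq : n ≤ 2 ^ q)
    (D : ℕ) (s : Fin n → Bool) {i : Fin n} (hi : i.val + 1 = n) :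
    ∀ (l : ℕ) (h : l + 1 ≤ (C.toTransformer D q M).numLayers),
      C.Holds M s l ((C.toTransformer D q M).hidden ρ s (l + 1) h i)
  | 0, _ => C.gatherLayer_forward hρ hF hnq (C.isInitial_hidden_zero hρ hF D s) hi
  | l + 1, h => C.gateLayer_forward hρ hF hq (holds_hidden hρ hF hq hnq D s hi l (by lia))

theorem logit_toTransformer (hρ : RoundsInto F ρ) (hF : HasRange F q M) (hq : 1 ≤ q)
    (hnq : n ≤ 2 ^ q) {D : ℕ} (hD : C.depth ≤ D) (s : Fin n → Bool) {i : Fin n}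
    (hi : i.val + 1 = n) (t : Bool) :
    (C.toTransformer D q M).logit ρ s i t = enc M (t == C.eval s) := by
  have h := C.holds_hidden hρ hF hq hnq D s hi D le_rfl
  rw [Transformer.logit]
  refine Eq.trans ?_ (hρ.eq_self (enc_mem hF _))
  congr 1
  refine (sum_hidden (S := C.size) _).trans ?_
  have hout : C.gateDepth C.output ≤ D := hD
  have hc : (C.toTransformer D q M).hidden ρ s (C.toTransformer D q M).numLayers le_rfl i
      (hiddenEquiv C.size const) = M := h.const
  have ht : (C.toTransformer D q M).hidden ρ s (C.toTransformer D q M).numLayers le_rfl i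
      (hiddenEquiv C.size (tgt C.output)) = enc M (C.stored s C.output) := by
    have := h.tgt C.output
    rwa [if_pos hout] at this
  rw [Finset.sum_eq_zero, Finset.sum_eq_single C.output, hc, ht]
  · rw [eval, stored]
    cases hv : C.val s C.output <;> cases ha : C.isAnd C.output <;> cases t <;>
      simp [toTransformer, logitWeight, ha, enc]
  · intro g _ hg
    simp [toTransformer, logitWeight, hg]
  · simp
  · intro g _
    simp [toTransformer, logitWeight]

theorem toTransformer_generates (hρ : RoundsInto F ρ) (hF : HasRange F q M) (hq : 1 ≤ q)
    (hnq : n ≤ 2 ^ q) {D : ℕ} (hD : C.depth ≤ D) (s : Fin n → Bool) :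
    (C.toTransformer D q M).Generates ρ s (C.eval s) := by
  intro i hi t ht
  have hsum : ∑ t', Real.exp (enc M (t' == C.eval s)) = Real.exp M + 1 := by
    cases C.eval s <;> simp [enc, add_comm]
  -- The logits are `M` and 0, so the probabilities are at least 3/4 and at most 1/4; the elements
  -- 1/2 and 1/4 of `F` keep them apart after truncation.
  have hexp : 3 ≤ Real.exp M := by linarith [Real.add_one_le_exp M, hF.two_le]
  simp only [Transformer.nextProb, C.logit_toTransformer hρ hF hq hnq hD s hi, hsum]
  have h4 : (1 / 4 : ℝ) ∈ F := by
    have := hF.inv_mem 2 (by lia)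
    norm_num at this ⊢
    exact this
  have h2 : (1 / 2 : ℝ) ∈ F := by
    have := hF.inv_mem 1 (by lia)
    norm_num at this ⊢
    exact this
  calc _ ≤ (1 / 4 : ℝ) := by
        refine hρ.le_of_le h4 ?_
        rw [beq_false_of_ne ht, div_le_iff₀ (by positivity)]
        simp only [enc, Bool.false_eq_true, if_false, Real.exp_zero]
        linarith
    _ < 1 / 2 := by norm_num
    _ ≤ _ := by
        refine hρ.ge_of_ge h2 ?_
        rw [beq_self_eq_true, le_div_iff₀ (by positivity)]
        simp only [enc, if_true]
        linarith

end BoolCircuit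

theorem PolyBounded.size_toTransformer {C : (n : ℕ) → BoolCircuit n}
    (hC : PolyBounded fun n => (C n).size) (D : ℕ) (q : ℕ → ℕ) (M : ℕ → ℝ) :
    PolyBounded fun n => ((C n).toTransformer D (q n) (M n)).size := by
  obtain ⟨p, hp⟩ := hC
  let w : Polynomial ℕ := 2 * p + 1
  refine ⟨2 * w + Polynomial.X * w +
    Polynomial.C (D + 1) * (4 * (w * w) + 2 * w ^ 2 + w) + 2 * w, fun n => ?_⟩
  have hw : 2 * (C n).size + 1 ≤ w.eval n := by
    have := hp n
    simp only [w, Polynomial.eval_add, Polynomial.eval_mul, Polynomial.eval_ofNat,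
      Polynomial.eval_one]
    lia
  simp only [Transformer.size, Transformer.dim, BoolCircuit.toTransformer, one_mul,
    Polynomial.eval_add, Polynomial.eval_mul, Polynomial.eval_ofNat, Polynomial.eval_X,
    Polynomial.eval_C, Polynomial.eval_pow]
  gcongr

theorem mainTheorem3 (κ : FormatKind) (r : RoundingMode)
    (C : (n : ℕ) → BoolCircuit n) (hC : IsAC0Family C) :
    ∃ (a b : ℕ → ℕ) (T : (n : ℕ) → Transformer n),
      LogBounded (fun n => κ.bits (a n) (b n)) ∧
      PolyBounded (fun n => (T n).size) ∧
      (∃ L : ℕ, ∀ n, (T n).numLayers ≤ L) ∧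
      (∀ n, (T n).ParamsIn (κ.values (a n) (b n))) ∧
      ∀ n, 1 ≤ n → ∀ ρ : ℝ → ℝ, r.IsRounding (κ.values (a n) (b n)) ρ →
        ∀ s : Fin n → Bool, (T n).Generates ρ s ((C n).eval s) := by
  obtain ⟨hsize, D, hD⟩ := hC
  let N : ℕ → ℕ := fun n => n + (C n).size
  have hN : PolyBounded N := by
    obtain ⟨p, hp⟩ := hsize
    refine ⟨Polynomial.X + p, fun n => ?_⟩
    rw [Polynomial.eval_add, Polynomial.eval_X]
    exact Nat.add_le_add_left (hp n) n
  -- The added 1 gives both `N n ≤ 2 ^ q n` and `1 ≤ q n`, the latter needed to undo GeLU.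
  let q : ℕ → ℕ := fun n => Nat.log 2 (N n) + 1
  have hNq : ∀ n, N n ≤ 2 ^ q n := fun n => (Nat.lt_pow_succ_log_self one_lt_two _).le
  choose M hM using fun n => κ.exists_hasRange (q n)
  refine ⟨fun n => q n + 4, fun n => q n + 4, fun n => (C n).toTransformer D (q n) (M n),
    ?_, hsize.size_toTransformer D q M, ⟨D + 1, fun n => le_rfl⟩, fun n => ?_,
    fun n _ ρ hρ s => ?_⟩
  · cases κ
    · convert hN.logBounded_log 2 11 using 2 with n
      simp only [FormatKind.bits, q]
      ring
    · convert hN.logBounded_log 2 12 using 2 with n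
      simp only [FormatKind.bits, q]
      ring
  · exact (C n).toTransformer_paramsIn (hM n) ((Nat.le_add_left _ _).trans (hNq n)) D
  · exact (C n).toTransformer_generates hρ.roundsInto (hM n) (Nat.le_add_left 1 _)
      ((Nat.le_add_right _ _).trans (hNq n)) (hD n) s
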